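/- Let $M,K,N\ge 1$ be integers, let $q\ge 0$ be real, and let $\log$ denote the logarithm to an arbitrary fixed base $b>1$. Let $Q_1$ and $Q_2$ be random complex matrices of sizes $K\times M$ and $N\times K$, such that all the entries of $Q_1$ and $Q_2$ together are independent and each is a circularly symmetric complex Gaussian random variable with mean zero and unit variance (its real and imaginary parts are independent real Gaussians with mean $0$ and variance $1/2$). Put $Q=Q_2Q_1$. Then $\log\det(I+q\,Q^{\dagger}Q)$ is integrable, and the ergodic capacity of the Rayleigh product channel $Q$ satisfies $$\mathbb{E}\big[\log\det(I+q\,Q^{\dagger}Q)\big]\;\ge\; L_1\log\!\big(1+q\exp(g-2\gamma)\big),$$ where $L_1=\min\{M,K,N\}$, $L_3=\max\{M,K,N\}$, $L_2=M+K+N-L_1-L_3$ is the remaining one of the three numbers, $$g=\frac1{L_1}\sum_{\ell=1}^{L_1}\big(H_{L_2-\ell}+H_{L_3-\ell}\big),\qquad H_n=\sum_{m=1}^{n}\frac1m\quad(H_0=0),$$ $\exp$ is the natural exponential and $\gamma$ is the Euler–Mascheroni constant. -/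

import Mathlib

open MeasureTheory ProbabilityTheory Matrix

namespace RayleighProduct

/-- The law of a circularly symmetric complex Gaussian variable with mean zero and unit variance:
real and imaginary parts are independent real Gaussians of mean `0` and variance `1/2`. -/
noncomputable def complexGaussian : Measure ℂ :=
  ((gaussianReal 0 (1 / 2)).prod (gaussianReal 0 (1 / 2))).map (fun p : ℝ × ℝ => (⟨p.1, p.2⟩ : ℂ))

/-- `Q₁` (of size `K × M`) and `Q₂` (of size `N × K`) are the two factors of a Rayleigh product
channel: all the entries of the two random matrices together are independent, and each of them is a
complex Gaussian variable with mean zero and unit variance. -/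
structure IsRayleighProduct {Ω : Type*} [MeasurableSpace Ω] {M K N : ℕ}
    (Q₁ : Ω → Matrix (Fin K) (Fin M) ℂ) (Q₂ : Ω → Matrix (Fin N) (Fin K) ℂ)
    (P : Measure Ω) : Prop where
  hasLaw_fst : ∀ k m, HasLaw (fun ω => Q₁ ω k m) complexGaussian P
  hasLaw_snd : ∀ n k, HasLaw (fun ω => Q₂ ω n k) complexGaussian P
  indep : iIndepFun
    (Sum.elim (fun (i : Fin K × Fin M) (ω : Ω) => Q₁ ω i.1 i.2)
      (fun (j : Fin N × Fin K) (ω : Ω) => Q₂ ω j.1 j.2)) P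

/-- The capacity `log det (I + q Q† Q)` of a channel matrix `Q`, the logarithm being to base `b`.
For `q ≥ 0` the matrix is Hermitian positive definite, so that its determinant is a positive
real number. -/
noncomputable def capacity (b q : ℝ) {M N : ℕ} (Q : Matrix (Fin N) (Fin M) ℂ) : ℝ :=
  Real.logb b ((1 : Matrix (Fin M) (Fin M) ℂ) + (q : ℂ) • (Qᴴ * Q)).det.re

/-- The ergodic capacity of a random channel matrix `Q`: the expectation of its capacity. -/
noncomputable def ergodicCapacity (b q : ℝ) {Ω : Type*} [MeasurableSpace Ω] {M N : ℕ}
    (Q : Ω → Matrix (Fin N) (Fin M) ℂ) (P : Measure Ω) : ℝ :=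
  ∫ ω, capacity b q (Q ω) ∂P

/-- The smallest of three numbers. -/
def L₁ (M K N : ℕ) : ℕ := min M (min K N)

/-- The largest of three numbers. -/
def L₃ (M K N : ℕ) : ℕ := max M (max K N)

/-- The number that remains of three when the smallest and the largest are removed. -/
def L₂ (M K N : ℕ) : ℕ := M + K + N - L₁ M K N - L₃ M K N

/-- `g = (1 / L₁) ∑_{ℓ = 1}^{L₁} (H_{L₂ - ℓ} + H_{L₃ - ℓ})`. -/
noncomputable def g (M K N : ℕ) : ℝ :=
  (1 / (L₁ M K N : ℝ)) * ∑ l ∈ Finset.Icc 1 (L₁ M K N),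
    ((harmonic (L₂ M K N - l) : ℝ) + (harmonic (L₃ M K N - l) : ℝ))

end RayleighProduct

/-! The function `x ↦ log (1 + q exp x)` is convex, so it lies above its tangent at any `m`. Summed
over the logarithms of the `L₁` almost surely nonzero eigenvalues of `Q† Q`, the tangents bound `log
det (I + q Q† Q)` below by an affine function of the logarithm of the product of these eigenvalues
(`log_det_one_add_ge`). At `m = g - 2γ` the linear term has mean zero (`le_integral_log_det`),
provided that this logarithm has mean exactly `L₁ (g - 2γ)`.

To compute that mean: the squared norm of a Gaussian vector in `ℂ^(n+1)` is Gamma distributed, with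
logarithmic mean `Γ'(n+1) / n! = H_n - γ` (`log_norm_sq_gaussianVector`). Orthogonalising rows
reduces the Gram determinant of one Gaussian matrix to such norms (`hasLogMean_wide`). The two
factors of `Q` contribute additively, by unitary invariance or because the determinant splits,
according to which dimension is least (`hasLogMean_mul_tall`, `hasLogMean_mul_wide`,
`hasLogMean_mul_inner`). -/

namespace RayleighProduct

/-! ### Complex Gaussian vectors and their unitary invariance -/

section

instance : IsProbabilityMeasure complexGaussian := by
  unfold complexGaussian
  exact Measure.isProbabilityMeasure_map
    Complex.measurableEquivRealProd.symm.measurable.aemeasurable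

lemma charFun_complexGaussian (t : ℂ) :
    charFun complexGaussian t = Complex.exp (-(‖t‖ ^ 2 / 4 : ℝ)) := by
  have hm : Measurable (fun p : ℝ × ℝ => (⟨p.1, p.2⟩ : ℂ)) :=
    Complex.measurableEquivRealProd.symm.measurable
  have key : charFun complexGaussian t =
      charFun (gaussianReal 0 (1 / 2)) t.re * charFun (gaussianReal 0 (1 / 2)) t.im := by
    rw [charFun_apply, complexGaussian, integral_map hm.aemeasurable (by fun_prop),
      charFun_apply, charFun_apply, ← integral_prod_mul]
    congr 1 with p
    rw [← Complex.exp_add]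
    congr 1
    simp [Complex.inner]
    ring
  rw [key, charFun_gaussianReal, charFun_gaussianReal, ← Complex.exp_add,
    ← Complex.normSq_eq_norm_sq,
    Complex.normSq_apply]
  congr 1
  push_cast
  norm_num
  ring

variable {ι κ : Type*} [Fintype ι] [Fintype κ]

/-- The law of a vector of independent standard complex Gaussian variables. -/
noncomputable abbrev gaussianVector (ι : Type*) [Fintype ι] : Measure (ι → ℂ) :=
  Measure.pi fun _ => complexGaussian

/-- Characteristic functions need the Euclidean inner product, while `ι → ℂ` carries the sup norm;
hence the passage to `PiLp 2`. -/
lemma charFun_map_toLp (μ : Measure (ι → ℂ)) (t : PiLp 2 (fun _ : ι => ℂ)) :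
    charFun (μ.map (WithLp.toLp 2)) t = ∫ z, Complex.exp ((star t.ofLp ⬝ᵥ z).re * Complex.I) ∂μ := by
  rw [charFun_apply, integral_map (by fun_prop) (by fun_prop)]
  congr 1 with z
  congr 3
  simp [PiLp.inner_apply, Complex.inner, dotProduct]

lemma integral_exp_gaussianVector (t : ι → ℂ) :
    ∫ z, Complex.exp ((star t ⬝ᵥ z).re * Complex.I) ∂(gaussianVector ι) =
      Complex.exp (-((∑ i, ‖t i‖ ^ 2) / 4 : ℝ)) := by
  have := charFun_map_toLp (gaussianVector ι) (WithLp.toLp 2 t)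
  simp only [] at this
  rw [← this, charFun_pi]
  simp only [charFun_complexGaussian, ← Complex.exp_sum]
  congr 1
  push_cast
  rw [Finset.sum_div, Finset.sum_neg_distrib]

lemma eq_gaussianVector (μ : Measure (ι → ℂ)) [IsFiniteMeasure μ]
    (h : ∀ t : ι → ℂ, ∫ z, Complex.exp ((star t ⬝ᵥ z).re * Complex.I) ∂μ =
      Complex.exp (-((∑ i, ‖t i‖ ^ 2) / 4 : ℝ))) : μ = gaussianVector ι := by
  have h1 : μ.map (WithLp.toLp 2) = (gaussianVector ι).map (WithLp.toLp 2) := by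
    refine Measure.ext_of_charFun (E := PiLp 2 (fun _ : ι => ℂ)) (funext fun t => ?_)
    rw [charFun_map_toLp, charFun_map_toLp, h, integral_exp_gaussianVector]
  exact (MeasurableEquiv.toLp 2 (ι → ℂ)).map_measurableEquiv_injective h1

lemma ofReal_sum_norm_sq (s : ι → ℂ) : ((∑ i, ‖s i‖ ^ 2 : ℝ) : ℂ) = s ⬝ᵥ star s := by
  simp [dotProduct, Complex.mul_conj, Complex.normSq_eq_norm_sq]

/-- Pairing `z U` with `t` is pairing `z` with `t U†`, which has the norm of `t`. `U` may be
rectangular, so this also covers coordinates on a subspace. -/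
lemma measurePreserving_vecMul [DecidableEq κ] (U : Matrix ι κ ℂ) (hU : Uᴴ * U = 1) :
    MeasurePreserving (fun z : ι → ℂ => z ᵥ* U) (gaussianVector ι) (gaussianVector κ) := by
  have hm : Measurable (fun z : ι → ℂ => z ᵥ* U) := by
    refine Continuous.measurable ?_
    fun_prop
  refine ⟨hm, ?_⟩
  have : IsProbabilityMeasure ((gaussianVector ι).map (fun z : ι → ℂ => z ᵥ* U)) :=
    Measure.isProbabilityMeasure_map hm.aemeasurable
  refine eq_gaussianVector _ fun t => ?_
  rw [integral_map hm.aemeasurable (by fun_prop)]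
  have h1 : ∀ z : ι → ℂ, star t ⬝ᵥ (z ᵥ* U) = star (t ᵥ* Uᴴ) ⬝ᵥ z := by
    intro z
    rw [star_vecMul, conjTranspose_conjTranspose, dotProduct_comm, ← dotProduct_mulVec,
      dotProduct_comm]
  simp_rw [h1]
  rw [integral_exp_gaussianVector]
  have h3 : (∑ i, ‖(t ᵥ* Uᴴ) i‖ ^ 2 : ℝ) = ∑ i, ‖t i‖ ^ 2 := by
    apply Complex.ofReal_injective
    rw [ofReal_sum_norm_sq, ofReal_sum_norm_sq, star_vecMul, conjTranspose_conjTranspose,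
      ← dotProduct_mulVec, mulVec_mulVec, hU, one_mulVec]
  rw [h3]

end

/-! ### Logarithmic mean of the squared norm of a Gaussian vector -/

section
variable {ι κ : Type*} [Fintype ι] [Fintype κ]

/-- The integral is `Γ'(n+1)`, obtained by differentiating the Mellin transform of `exp (-x)`. -/
lemma integral_pow_mul_exp_mul_log (n : ℕ) :
    IntegrableOn (fun x : ℝ => x ^ n * Real.exp (-x) * Real.log x) (Set.Ioi 0) ∧
    ∫ x in Set.Ioi (0 : ℝ), x ^ n * Real.exp (-x) * Real.log x =
      n.factorial * (harmonic n - Real.eulerMascheroniConstant) := by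
  have hre : (0 : ℝ) < (n + 1 : ℂ).re := by simp; positivity
  -- `exp (-x)` is bounded near `0`, so `b = 0`; at infinity it beats every power, so any `a` above
  -- the real part of `s` will do.
  have key := mellin_hasDerivAt_of_isBigO_rpow (E := ℂ)
    (f := fun x : ℝ => ((Real.exp (-x) : ℝ) : ℂ))
    (a := (n + 1 : ℂ).re + 1) (b := 0) (s := n + 1) ?_ ?_ (lt_add_one _) ?_ hre
  rotate_left
  · refine (Continuous.continuousOn ?_).locallyIntegrableOn measurableSet_Ioi
    fun_prop
  · rw [← Asymptotics.isBigO_norm_left]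
    simp_rw [Complex.norm_real, Asymptotics.isBigO_norm_left]
    simpa only [neg_one_mul] using (isLittleO_exp_neg_mul_rpow_atTop zero_lt_one _).isBigO
  · simp_rw [neg_zero, Real.rpow_zero]
    refine Asymptotics.isBigO_const_of_tendsto
      (?_ : Filter.Tendsto _ _ (nhds (1 : ℂ))) one_ne_zero
    rw [(by simp : (1 : ℂ) = Real.exp (-0))]
    exact (by fun_prop : Continuous fun x : ℝ => ((Real.exp (-x) : ℝ) : ℂ)).continuousWithinAt
  obtain ⟨hconv, hder⟩ := key
  have hfun : ∀ t : ℝ, (t : ℂ) ^ ((n + 1 : ℂ) - 1) • (Real.log t • ((Real.exp (-t) : ℝ) : ℂ)) =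
      ((t ^ n * Real.exp (-t) * Real.log t : ℝ) : ℂ) := by
    intro t
    rw [add_sub_cancel_right, Complex.cpow_natCast]
    simp only [smul_eq_mul, Complex.real_smul]
    push_cast
    ring
  constructor
  · have := hconv
    unfold MellinConvergent at this
    simp_rw [hfun] at this
    simpa only [RCLike.re_to_complex, Complex.ofReal_re] using! this.re
  · rw [← Complex.GammaIntegral_eq_mellin] at hder
    have h1 : HasDerivAt Complex.Gamma
        (mellin (fun t : ℝ => Real.log t • ((Real.exp (-t) : ℝ) : ℂ)) (n + 1))
        (n + 1) := by
      refine hder.congr_of_eventuallyEq ?_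
      have : ∀ᶠ s : ℂ in nhds (n + 1 : ℂ), 0 < s.re :=
        (Complex.continuous_re.isOpen_preimage _ isOpen_Ioi).mem_nhds hre
      filter_upwards [this] with s hs using Complex.Gamma_eq_integral hs
    have h2 := h1.unique (Complex.hasDerivAt_Gamma_nat n)
    unfold mellin at h2
    simp_rw [hfun] at h2
    rw [integral_complex_ofReal] at h2
    have h3 := Complex.ofReal_injective (h2.trans
      (b := (n.factorial : ℂ) * (-Real.eulerMascheroniConstant + harmonic n))
      (c := ((n.factorial * (harmonic n - Real.eulerMascheroniConstant) : ℝ) : ℂ))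
      (by push_cast; ring))
    exact h3
section
variable {V : Type*} [NormedAddCommGroup V] [InnerProductSpace ℝ V] [FiniteDimensional ℝ V]
  [MeasurableSpace V] [BorelSpace V]

/-- The density `π ^ (-d / 2) exp (-‖x‖²)` of a centered Gaussian law on a real inner product space of
dimension `d`. -/
noncomputable def gaussDensity (V : Type*) [NormedAddCommGroup V] [InnerProductSpace ℝ V]
    (x : V) : ℝ :=
  Real.exp (- ‖x‖ ^ 2) / Real.pi ^ ((Module.finrank ℝ V : ℝ) / 2)

lemma integrable_gaussDensity : Integrable (gaussDensity V) := by
  have := (GaussianFourier.integrable_cexp_neg_mul_sq_norm_add (V := V) (b := 1) (by simp) 0 0).re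
  refine (this.div_const (Real.pi ^ ((Module.finrank ℝ V : ℝ) / 2))).congr (ae_of_all _ fun x => ?_)
  simp only [gaussDensity]
  congr 1
  simp
  rw [← Complex.ofReal_pow, ← Complex.ofReal_neg, Complex.exp_ofReal_re]

omit [FiniteDimensional ℝ V] [MeasurableSpace V] [BorelSpace V] in
lemma gaussDensity_nonneg (x : V) : 0 ≤ gaussDensity V x := by unfold gaussDensity; positivity

/-- The centered Gaussian measure with density `gaussDensity`. -/
noncomputable def gaussMeasure (V : Type*) [NormedAddCommGroup V] [InnerProductSpace ℝ V]
   [FiniteDimensional ℝ V] [MeasurableSpace V] [BorelSpace V] : Measure V :=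
  volume.withDensity fun x => ENNReal.ofReal (gaussDensity V x)

instance : IsFiniteMeasure (gaussMeasure V) :=
  isFiniteMeasure_withDensity_ofReal integrable_gaussDensity.2

omit [FiniteDimensional ℝ V] [MeasurableSpace V] [BorelSpace V] in
lemma continuous_gaussDensity : Continuous (gaussDensity V) := by
  unfold gaussDensity; fun_prop

lemma integral_gaussMeasure {E : Type*} [NormedAddCommGroup E] [NormedSpace ℝ E] (f : V → E) :
    ∫ x, f x ∂(gaussMeasure V) = ∫ x, gaussDensity V x • f x := by
  rw [gaussMeasure, integral_withDensity_eq_integral_toReal_smul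
    (continuous_gaussDensity.measurable.ennreal_ofReal) (by simp)]
  simp [ENNReal.toReal_ofReal (gaussDensity_nonneg _)]

lemma integrable_gaussMeasure {E : Type*} [NormedAddCommGroup E] [NormedSpace ℝ E] (f : V → E) :
    Integrable f (gaussMeasure V) ↔ Integrable (fun x => gaussDensity V x • f x) := by
  rw [gaussMeasure, integrable_withDensity_iff_integrable_smul'
    (continuous_gaussDensity.measurable.ennreal_ofReal) (by simp)]
  simp [ENNReal.toReal_ofReal (gaussDensity_nonneg _)]

lemma charFun_gaussMeasure (t : V) :
    charFun (gaussMeasure V) t = Complex.exp (-(‖t‖ ^ 2 / 4 : ℝ)) := by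
  rw [charFun_apply, integral_gaussMeasure]
  have := GaussianFourier.integral_cexp_neg_mul_sq_norm_add (V := V) (b := 1) (by simp) Complex.I t
  have h2 : (Real.pi / 1 : ℂ) ^ (Module.finrank ℝ V / 2 : ℂ) =
      (Real.pi ^ ((Module.finrank ℝ V : ℝ) / 2) : ℝ) := by
    rw [Complex.ofReal_cpow Real.pi_pos.le]; simp
  rw [h2] at this
  calc _ = (∫ v : V, Complex.exp (-1 * ‖v‖ ^ 2 + Complex.I * (inner ℝ t v : ℝ))) /
        (Real.pi ^ ((Module.finrank ℝ V : ℝ) / 2) : ℝ) := by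
        rw [← integral_div]
        congr 1 with v
        simp only [gaussDensity, Complex.real_smul, Complex.exp_add]
        push_cast
        rw [real_inner_comm]
        ring_nf
    _ = _ := by
      rw [this, mul_div_cancel_left₀]
      · congr 1; simp; ring
      · norm_cast; positivity

/-- Polar coordinates and the substitution `x = y ^ 2`. The prefactor need not be evaluated: the
case `f = 1` determines it. -/
lemma integral_gaussMeasure_norm_sq {n : ℕ} (hn : Module.finrank ℝ V = 2 * (n + 1)) (f : ℝ → ℝ) :
    ∫ x : V, f (‖x‖ ^ 2) ∂(gaussMeasure V) =
      ((Module.finrank ℝ V : ℝ) * volume.real (Metric.ball (0 : V) 1) *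
        (2 * Real.pi ^ ((Module.finrank ℝ V : ℝ) / 2))⁻¹) *
        ∫ x in Set.Ioi (0 : ℝ), x ^ n * Real.exp (-x) * f x := by
  have : Nontrivial V := Module.nontrivial_of_finrank_pos (R := ℝ) (by omega)
  rw [integral_gaussMeasure]
  have h := integral_fun_norm_addHaar (volume : Measure V)
    (fun y => Real.exp (-y ^ 2) / Real.pi ^ ((Module.finrank ℝ V : ℝ) / 2) * f (y ^ 2))
  simp only [gaussDensity, smul_eq_mul] at h ⊢
  rw [h, nsmul_eq_mul, ← integral_comp_rpow_Ioi_of_pos (g := fun x => x ^ n * Real.exp (-x) * f x)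
    (two_pos (α := ℝ)), mul_assoc, mul_assoc]
  congr 2
  rw [← integral_const_mul]
  refine setIntegral_congr_fun measurableSet_Ioi fun y hy => ?_
  have h1 : y ^ ((2 : ℝ) - 1) = y := by norm_num
  have h2 : Module.finrank ℝ V - 1 = 2 * n + 1 := by omega
  simp only [Real.rpow_two, h1, smul_eq_mul, h2]
  have : Real.pi ^ ((Module.finrank ℝ V : ℝ) / 2) ≠ 0 := by positivity
  field_simp
  ring

lemma integrable_gaussMeasure_norm_sq {n : ℕ} (hn : Module.finrank ℝ V = 2 * (n + 1)) {f : ℝ → ℝ}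
    (hf : IntegrableOn (fun x => x ^ n * Real.exp (-x) * f x) (Set.Ioi 0)) :
    Integrable (fun x : V => f (‖x‖ ^ 2)) (gaussMeasure V) := by
  have : Nontrivial V := Module.nontrivial_of_finrank_pos (R := ℝ) (by omega)
  rw [integrable_gaussMeasure]
  have h := integrable_fun_norm_addHaar (volume : Measure V) (f :=
    (fun y => Real.exp (-y ^ 2) / Real.pi ^ ((Module.finrank ℝ V : ℝ) / 2) * f (y ^ 2)))
  simp only [gaussDensity, smul_eq_mul] at h ⊢
  rw [h]
  rw [← integrableOn_Ioi_comp_rpow_iff _ two_ne_zero] at hf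
  refine IntegrableOn.congr_fun (hf.const_mul (2 * Real.pi ^ ((Module.finrank ℝ V : ℝ) / 2))⁻¹)
    (fun y hy => ?_) measurableSet_Ioi
  have h1 : y ^ ((2 : ℝ) - 1) = y := by norm_num
  have h2 : Module.finrank ℝ V - 1 = 2 * n + 1 := by omega
  simp only [Real.rpow_two, h1, smul_eq_mul, h2, abs_two]
  have : Real.pi ^ ((Module.finrank ℝ V : ℝ) / 2) ≠ 0 := by positivity
  field_simp
  ring

lemma log_norm_sq_gaussMeasure {n : ℕ} (hn : Module.finrank ℝ V = 2 * (n + 1)) :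
    Integrable (fun x : V => Real.log (‖x‖ ^ 2)) (gaussMeasure V) ∧
    ∫ x : V, Real.log (‖x‖ ^ 2) ∂(gaussMeasure V) =
      harmonic n - Real.eulerMascheroniConstant := by
  obtain ⟨h1, h2⟩ := integral_pow_mul_exp_mul_log n
  refine ⟨integrable_gaussMeasure_norm_sq hn h1, ?_⟩
  have hone : ∫ _ : V, (1 : ℝ) ∂(gaussMeasure V) = 1 := by
    have h := charFun_gaussMeasure (0 : V)
    rw [charFun_zero] at h
    simp at h
    simpa using h
  have hG : ∫ x in Set.Ioi (0 : ℝ), x ^ n * Real.exp (-x) * 1 = n.factorial := by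
    rw [← Real.Gamma_nat_eq_factorial, Real.Gamma_eq_integral (by positivity)]
    refine setIntegral_congr_fun measurableSet_Ioi fun y hy => ?_
    simp [mul_comm]
  -- Total mass one says that the prefactor is `1 / n!`.
  have h3 := integral_gaussMeasure_norm_sq hn (fun _ => 1)
  rw [hone, hG] at h3
  rw [integral_gaussMeasure_norm_sq hn Real.log, h2, ← mul_assoc, ← h3, one_mul]

end

/-- Identifies the product law with the one given by a radial density, for which polar coordinates
are available. -/
lemma map_toLp_gaussianVector :
    (gaussianVector ι).map (WithLp.toLp 2) = gaussMeasure (PiLp 2 (fun _ : ι => ℂ)) := by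
  refine Measure.ext_of_charFun (E := PiLp 2 (fun _ : ι => ℂ)) (funext fun t => ?_)
  rw [charFun_map_toLp, integral_exp_gaussianVector, charFun_gaussMeasure, PiLp.norm_sq_eq_of_L2]

lemma log_norm_sq_gaussianVector {n : ℕ} (hn : Fintype.card ι = n + 1) :
    Integrable (fun z => Real.log (∑ i, ‖z i‖ ^ 2)) (gaussianVector ι) ∧
    ∫ z, Real.log (∑ i, ‖z i‖ ^ 2) ∂(gaussianVector ι) =
      harmonic n - Real.eulerMascheroniConstant := by
  have hfin : Module.finrank ℝ (PiLp 2 (fun _ : ι => ℂ)) = 2 * (n + 1) := by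
    rw [(WithLp.linearEquiv 2 ℝ (ι → ℂ)).finrank_eq, Module.finrank_pi_fintype]
    simp [hn, mul_comm]
  obtain ⟨h1, h2⟩ := log_norm_sq_gaussMeasure (V := PiLp 2 (fun _ : ι => ℂ)) hfin
  rw [← map_toLp_gaussianVector] at h1 h2
  rw [← MeasurableEquiv.coe_toLp, integrable_map_equiv] at h1
  rw [← MeasurableEquiv.coe_toLp, integral_map_equiv] at h2
  simp only [PiLp.norm_sq_eq_of_L2] at h1 h2
  exact ⟨h1, h2⟩

lemma ae_ne_zero_gaussianVector [Nonempty ι] : ∀ᵐ z ∂(gaussianVector ι), z ≠ 0 := by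
  have h0 : gaussMeasure (PiLp 2 (fun _ : ι => ℂ)) {0} = 0 :=
    withDensity_absolutelyContinuous _ _ (measure_singleton _)
  rw [← map_toLp_gaussianVector, ← MeasurableEquiv.coe_toLp, MeasurableEquiv.map_apply] at h0
  rw [ae_iff]
  convert h0 using 2
  ext z
  simp

end

/-! ### Gaussian matrices and additivity of logarithmic means -/

section
variable {ι κ : Type*} [Fintype ι] [Fintype κ]

noncomputable instance {ι κ : Type*} : MeasurableSpace (Matrix ι κ ℂ) :=
  inferInstanceAs (MeasurableSpace (ι → κ → ℂ))

instance {ι κ : Type*} [Countable ι] [Countable κ] : BorelSpace (Matrix ι κ ℂ) :=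
  inferInstanceAs (BorelSpace (ι → κ → ℂ))

instance {ι κ : Type*} [Countable ι] [Countable κ] : SecondCountableTopology (Matrix ι κ ℂ) :=
  inferInstanceAs (SecondCountableTopology (ι → κ → ℂ))

/-- The law of a matrix of independent standard complex Gaussian variables. -/
noncomputable def gaussianMatrix (ι κ : Type*) [Fintype ι] [Fintype κ] : Measure (Matrix ι κ ℂ) :=
  (Measure.pi fun _ : ι => gaussianVector κ : Measure (ι → κ → ℂ))

instance : IsProbabilityMeasure (gaussianMatrix ι κ) :=
  inferInstanceAs (IsProbabilityMeasure (Measure.pi fun _ : ι => gaussianVector κ))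

lemma measurePreserving_uncurry :
    MeasurePreserving (fun (G : Matrix ι κ ℂ) (p : ι × κ) => G p.1 p.2)
      (gaussianMatrix ι κ) (gaussianVector (ι × κ)) := by
  have hm : Measurable (fun (G : Matrix ι κ ℂ) (p : ι × κ) => G p.1 p.2) :=
    Continuous.measurable (by fun_prop)
  have : IsProbabilityMeasure
      ((gaussianMatrix ι κ).map (fun (G : Matrix ι κ ℂ) (p : ι × κ) => G p.1 p.2)) :=
    Measure.isProbabilityMeasure_map hm.aemeasurable
  refine ⟨hm, eq_gaussianVector _ fun t => ?_⟩
  rw [integral_map hm.aemeasurable (by fun_prop)]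
  have h1 : ∀ G : ι → κ → ℂ, Complex.exp ((star t ⬝ᵥ fun p : ι × κ => G p.1 p.2).re * Complex.I) =
      ∏ i, Complex.exp ((star (fun k => t (i, k)) ⬝ᵥ G i).re * Complex.I) := by
    intro G
    rw [← Complex.exp_sum, ← Finset.sum_mul, ← Complex.ofReal_sum, ← Complex.re_sum]
    simp [dotProduct, Fintype.sum_prod_type]
  refine (integral_congr_ae (ae_of_all _ h1)).trans ?_
  refine (integral_fintype_prod_eq_prod (μ := fun _ : ι => gaussianVector κ)
    fun i g => Complex.exp ((star (fun k => t (i, k)) ⬝ᵥ g).re * Complex.I)).trans ?_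
  simp only [integral_exp_gaussianVector, ← Complex.exp_sum]
  congr 1
  rw [Fintype.sum_prod_type]
  push_cast
  rw [Finset.sum_div, Finset.sum_neg_distrib]

/-- Matrices as vectors indexed by the pairs of indices. -/
noncomputable def uncurryEquiv (ι κ : Type*) : Matrix ι κ ℂ ≃ᵐ (ι × κ → ℂ) where
  toFun G p := G p.1 p.2
  invFun g := of fun i k => g (i, k)
  left_inv _ := rfl
  right_inv _ := rfl
  measurable_toFun := measurable_pi_lambda _ fun p =>
    (measurable_pi_apply p.2).comp (measurable_pi_apply (X := fun _ : ι => κ → ℂ) p.1)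
  measurable_invFun := measurable_pi_lambda _ fun i => measurable_pi_lambda _ fun k =>
    measurable_pi_apply (i, k)

lemma measurePreserving_uncurryEquiv_symm :
    MeasurePreserving (uncurryEquiv ι κ).symm (gaussianVector (ι × κ)) (gaussianMatrix ι κ) :=
  MeasurePreserving.symm (uncurryEquiv ι κ) measurePreserving_uncurry

lemma measurePreserving_transpose :
    MeasurePreserving (transpose : Matrix ι κ ℂ → Matrix κ ι ℂ)
      (gaussianMatrix ι κ) (gaussianMatrix κ ι) := by
  have h := (measurePreserving_uncurryEquiv_symm (ι := κ) (κ := ι)).comp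
    ((measurePreserving_piCongrLeft (fun _ : κ × ι => complexGaussian) (Equiv.prodComm ι κ)).comp
      (measurePreserving_uncurry (ι := ι) (κ := κ)))
  exact h

lemma measurePreserving_mul_right {ρ : Type*} [Fintype ρ] [DecidableEq ρ] (U : Matrix κ ρ ℂ)
    (hU : Uᴴ * U = 1) :
    MeasurePreserving (fun G : Matrix ι κ ℂ => G * U) (gaussianMatrix ι κ) (gaussianMatrix ι ρ) :=
  measurePreserving_pi (fun _ : ι => gaussianVector κ) (fun _ : ι => gaussianVector ρ)
    fun _ => measurePreserving_vecMul U hU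

/-- The function `D` vanishes almost nowhere, and the mean of `log ‖D‖` exists and equals `m`. -/
structure HasLogMean {α : Type*} [MeasurableSpace α] (D : α → ℂ) (μ : Measure α) (m : ℝ) : Prop where
  ae_ne_zero : ∀ᵐ a ∂μ, D a ≠ 0
  integrable : Integrable (fun a => Real.log ‖D a‖) μ
  integral_eq : ∫ a, Real.log ‖D a‖ ∂μ = m

section
variable {α β β' : Type*} [MeasurableSpace α] [MeasurableSpace β] [MeasurableSpace β']
  {μ : Measure α} {ν : Measure β} {ν' : Measure β'}

lemma HasLogMean.comp {D : β → ℂ} {m : ℝ} (hD : HasLogMean D ν m) {f : α → β}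
    (hf : MeasurePreserving f μ ν) : HasLogMean (fun a => D (f a)) μ m where
  ae_ne_zero := hf.quasiMeasurePreserving.ae hD.ae_ne_zero
  integrable := hf.integrable_comp_of_integrable hD.integrable
  integral_eq := by
    rw [← hD.integral_eq, ← hf.map_eq, integral_map hf.aemeasurable]
    rw [hf.map_eq]
    exact hD.integrable.1

lemma HasLogMean.congr {D D' : α → ℂ} {m : ℝ} (hD : HasLogMean D μ m) (h : ∀ a, ‖D a‖ = ‖D' a‖) :
    HasLogMean D' μ m where
  ae_ne_zero := by
    filter_upwards [hD.ae_ne_zero] with a ha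
    rwa [← norm_ne_zero_iff, ← h, norm_ne_zero_iff]
  integrable := by simpa only [h] using hD.integrable
  integral_eq := by simpa only [h] using hD.integral_eq

/-- If almost every section of `D` is a multiple of `D₂` composed with a measure preserving map, then
the logarithmic means add up. -/
lemma HasLogMean.prod_of_section [IsProbabilityMeasure μ] [IsProbabilityMeasure ν]
    {D : α × β → ℂ} {D₁ : α → ℂ} {D₂ : β' → ℂ} {m₁ m₂ : ℝ} (hD : Measurable D)
    (h₁ : HasLogMean D₁ μ m₁) (h₂ : HasLogMean D₂ ν' m₂)
    (h : ∀ᵐ a ∂μ, ∃ T : β → β', MeasurePreserving T ν ν' ∧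
      ∀ b, ‖D (a, b)‖ = ‖D₁ a‖ * ‖D₂ (T b)‖) :
    HasLogMean D (μ.prod ν) (m₁ + m₂) := by
  have hlog : Measurable fun p => Real.log ‖D p‖ := Real.measurable_log.comp hD.norm
  -- The second half bounds the `L¹` norms of the sections by an integrable function of `a`, as
  -- integrability on the product requires.
  have key : ∀ᵐ a ∂μ, HasLogMean (fun b => D (a, b)) ν (Real.log ‖D₁ a‖ + m₂) ∧
      ∫ b, ‖Real.log ‖D (a, b)‖‖ ∂ν ≤ ‖Real.log ‖D₁ a‖‖ + ∫ b', ‖Real.log ‖D₂ b'‖‖ ∂ν' := by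
    filter_upwards [h, h₁.ae_ne_zero] with a ⟨T, hT, hDT⟩ ha
    have h₃ := h₂.comp hT
    have hlogsum : ∀ᵐ b ∂ν, Real.log ‖D₁ a‖ + Real.log ‖D₂ (T b)‖ = Real.log ‖D (a, b)‖ := by
      filter_upwards [h₃.ae_ne_zero] with b hb
      rw [hDT, Real.log_mul (norm_ne_zero_iff.2 ha) (norm_ne_zero_iff.2 hb)]
    have hi := ((integrable_const (Real.log ‖D₁ a‖)).add h₃.integrable).congr hlogsum
    refine ⟨⟨?_, hi, ?_⟩, ?_⟩
    · filter_upwards [h₃.ae_ne_zero] with b hb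
      rw [← norm_ne_zero_iff, hDT]
      exact mul_ne_zero (norm_ne_zero_iff.2 ha) (norm_ne_zero_iff.2 hb)
    · rw [← integral_congr_ae hlogsum, integral_add (integrable_const _) h₃.integrable,
        h₃.integral_eq]
      simp
    · have e : ∫ b', ‖Real.log ‖D₂ b'‖‖ ∂ν' = ∫ b, ‖Real.log ‖D₂ (T b)‖‖ ∂ν := by
        rw [← hT.map_eq, integral_map hT.aemeasurable]
        rw [hT.map_eq]
        exact h₂.integrable.norm.1
      calc ∫ b, ‖Real.log ‖D (a, b)‖‖ ∂ν
          ≤ ∫ b, (‖Real.log ‖D₁ a‖‖ + ‖Real.log ‖D₂ (T b)‖‖) ∂ν := by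
            refine integral_mono_ae hi.norm ((integrable_const _).add h₃.integrable.norm) ?_
            filter_upwards [hlogsum] with b hb
            rw [← hb]
            exact norm_add_le _ _
        _ = _ := by
            rw [integral_add (integrable_const _) h₃.integrable.norm, e]
            simp
  have hint : Integrable (fun p => Real.log ‖D p‖) (μ.prod ν) := by
    rw [integrable_prod_iff hlog.aestronglyMeasurable]
    refine ⟨key.mono fun a ha => ha.1.integrable, ?_⟩
    refine (h₁.integrable.norm.add (integrable_const (∫ b', ‖Real.log ‖D₂ b'‖‖ ∂ν'))).mono'
      (hlog.norm.stronglyMeasurable.integral_prod_right).aestronglyMeasurable ?_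
    filter_upwards [key] with a ha
    rw [Real.norm_of_nonneg (integral_nonneg fun _ => norm_nonneg _)]
    exact ha.2
  refine ⟨?_, hint, ?_⟩
  · have hs : MeasurableSet {p | D p = 0} := hD (measurableSet_singleton 0)
    have : (μ.prod ν) {p | D p = 0} = 0 := by
      rw [Measure.measure_prod_null hs]
      filter_upwards [key] with a ha
      have := ha.1.ae_ne_zero
      rw [ae_iff] at this
      simpa using this
    rw [ae_iff]
    simpa using this
  · rw [integral_prod _ hint]
    rw [integral_congr_ae (g := fun a => Real.log ‖D₁ a‖ + m₂)
      (key.mono fun a ha => ha.1.integral_eq),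
      integral_add h₁.integrable (integrable_const _), h₁.integral_eq]
    simp
end

end

/-! ### Logarithmic mean of the Gram determinant of a Gaussian matrix -/

section
variable {ι κ : Type*} [Fintype ι] [Fintype κ]

lemma sum_norm_sq_pos {v : ι → ℂ} (hv : v ≠ 0) : 0 < ∑ i, ‖v i‖ ^ 2 := by
  obtain ⟨i, hi⟩ := Function.ne_iff.1 hv
  exact Finset.sum_pos' (fun _ _ => by positivity) ⟨i, Finset.mem_univ i, by
    have := norm_pos_iff.2 hi
    positivity⟩

/-- The orthogonal complement of a nonzero row vector is spanned by orthonormal vectors. -/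
lemma exists_isometry_orthogonal {N : ℕ} {v : Fin (N + 1) → ℂ} (hv : v ≠ 0) :
    ∃ U : Matrix (Fin (N + 1)) (Fin N) ℂ, Uᴴ * U = 1 ∧
      ∀ a b, (U * Uᴴ) a b = (1 : Matrix (Fin (N + 1)) (Fin (N + 1)) ℂ) a b -
        star (v a) * v b / (∑ i, ‖v i‖ ^ 2 : ℝ) := by
  -- The conjugate appears because `v ⬝ᵥ u` is the Hermitian product of `star v` and `u`. The
  -- normalised `w` becomes column `0` of a unitary `W`, and `U` consists of the other columns.
  set w : EuclideanSpace ℂ (Fin (N + 1)) := WithLp.toLp 2 (star v) with hw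
  have hw0 : w ≠ 0 := by
    intro h
    apply hv
    ext i
    have := congrArg (fun x : EuclideanSpace ℂ (Fin (N + 1)) => x i) h
    simpa [hw] using this
  have hwn : ‖w‖ ≠ 0 := norm_ne_zero_iff.2 hw0
  have hws : ‖w‖ ^ 2 = ∑ i, ‖v i‖ ^ 2 := by simp [EuclideanSpace.norm_sq_eq, hw]
  have ho : Orthonormal ℂ (({0} : Set (Fin (N + 1))).domRestrict
      fun _ => ((‖w‖⁻¹ : ℝ) : ℂ) • w) := by
    constructor
    · rintro ⟨i, hi⟩
      simp [Set.domRestrict, norm_smul, hwn]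
    · rintro ⟨i, hi⟩ ⟨j, hj⟩ hij
      exact absurd (Subtype.ext (hi.trans hj.symm)) hij
  obtain ⟨b, hb⟩ := ho.exists_orthonormalBasis_extension_of_card_eq (by simp)
  have hb0 : b 0 = ((‖w‖⁻¹ : ℝ) : ℂ) • w := hb 0 rfl
  set W : Matrix (Fin (N + 1)) (Fin (N + 1)) ℂ := of fun i j => b j i with hW
  have hWW : Wᴴ * W = 1 := by
    ext i j
    have := orthonormal_iff_ite.1 b.orthonormal i j
    simp only [PiLp.inner_apply, RCLike.inner_apply] at this
    rw [one_apply, ← this]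
    simp [mul_apply, hW, mul_comm]
  have hWW' : W * Wᴴ = 1 := mul_eq_one_comm.1 hWW
  refine ⟨W.submatrix id Fin.succ, ?_, fun a c => ?_⟩
  · ext i j
    have := congrFun (congrFun hWW i.succ) j.succ
    simp only [mul_apply, conjTranspose_apply] at this
    simp only [mul_apply, conjTranspose_apply, submatrix_apply, id]
    rw [this]
    simp [one_apply]
  · have h := congrFun (congrFun hWW' a) c
    rw [mul_apply, Fin.sum_univ_succ] at h
    rw [← h, mul_apply, eq_sub_iff_add_eq, add_comm]
    congr 1
    rw [← hws]
    have : (‖w‖ : ℂ) ≠ 0 := by exact_mod_cast hwn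
    simp [hW, hb0, hw]
    field_simp

/-- Clearing the first column of the Gram matrix by multiples of its first row leaves the Schur
complement `G G† - G v† v G† / ‖v‖²`, which is `G U U† G†`. -/
lemma det_cons_mul_conjTranspose {L N : ℕ} {v : Fin (N + 1) → ℂ} (hv : v ≠ 0)
    {U : Matrix (Fin (N + 1)) (Fin N) ℂ}
    (hU : ∀ a b, (U * Uᴴ) a b = (1 : Matrix (Fin (N + 1)) (Fin (N + 1)) ℂ) a b -
        star (v a) * v b / (∑ i, ‖v i‖ ^ 2 : ℝ)) (G : Matrix (Fin L) (Fin (N + 1)) ℂ) :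
    (of (vecCons v G) * (of (vecCons v G))ᴴ).det =
      ((∑ i, ‖v i‖ ^ 2 : ℝ) : ℂ) * ((G * U) * (G * U)ᴴ).det := by
  set s : ℂ := ((∑ i, ‖v i‖ ^ 2 : ℝ) : ℂ) with hs
  have hsv : s = v ⬝ᵥ star v := ofReal_sum_norm_sq v
  have hs0 : s ≠ 0 := Complex.ofReal_ne_zero.2 (sum_norm_sq_pos hv).ne'
  set B : Matrix (Fin (L + 1)) (Fin (L + 1)) ℂ :=
    of (vecCons (vecCons s fun j => v ⬝ᵥ star (G j)) fun i =>
      vecCons 0 fun j => ((G * U) * (G * U)ᴴ) i j)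
    with hB
  have h1 : ∀ i j, (G * U * (G * U)ᴴ) i j =
      G i ⬝ᵥ star (G j) - G i ⬝ᵥ star v * (v ⬝ᵥ star (G j)) / s := by
    intro i j
    have e : U * Uᴴ = 1 - s⁻¹ • vecMulVec (star v) v := by
      ext a b
      rw [hU]
      simp [vecMulVec_apply, div_eq_inv_mul]
    rw [conjTranspose_mul, Matrix.mul_assoc, ← Matrix.mul_assoc U, e, Matrix.sub_mul, Matrix.mul_sub,
      Matrix.one_mul, Matrix.smul_mul, Matrix.mul_smul, vecMulVec_mul, mul_vecMulVec]
    simp only [Matrix.sub_apply, Matrix.smul_apply, vecMulVec_apply, smul_eq_mul]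
    rw [div_eq_inv_mul]
    rfl
  rw [det_eq_of_forall_row_eq_smul_add_const (B := B)
    (vecCons 0 fun i => (G i ⬝ᵥ star v) / s) 0 rfl]
  · rw [det_succ_column_zero, Fin.sum_univ_succ]
    simp [hB]
    left
    rfl
  · intro i j
    refine Fin.cases ?_ (fun i => ?_) i <;> refine Fin.cases ?_ (fun j => ?_) j
    · simp [hB, hsv]; rfl
    · simp [hB]; rfl
    · simp [hB, hs0]; rfl
    · have : (of (vecCons v G) * (of (vecCons v G))ᴴ) i.succ j.succ = G i ⬝ᵥ star (G j) := rfl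
      rw [this]
      simp only [hB, of_apply, cons_val_succ, cons_val_zero, h1]
      ring

lemma hasLogMean_gaussianVector {n : ℕ} :
    HasLogMean (fun v : Fin (n + 1) → ℂ => ((∑ i, ‖v i‖ ^ 2 : ℝ) : ℂ)) (gaussianVector (Fin (n + 1)))
      (harmonic n - Real.eulerMascheroniConstant) := by
  obtain ⟨h1, h2⟩ := log_norm_sq_gaussianVector (ι := Fin (n + 1)) (Fintype.card_fin _)
  have h : ∀ v : Fin (n + 1) → ℂ, ‖((∑ i, ‖v i‖ ^ 2 : ℝ) : ℂ)‖ = ∑ i, ‖v i‖ ^ 2 := fun v =>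
    Complex.norm_of_nonneg (by positivity)
  refine ⟨?_, by simpa only [h] using h1, by simpa only [h] using h2⟩
  filter_upwards [ae_ne_zero_gaussianVector (ι := Fin (n + 1))] with v hv
  exact Complex.ofReal_ne_zero.2 (sum_norm_sq_pos hv).ne'

/-- `∑ l = 1, …, L` of `ψ (N - l + 1)`. -/
noncomputable def digammaSum (L N : ℕ) : ℝ :=
  ∑ l ∈ Finset.Icc 1 L, ((harmonic (N - l) : ℝ) - Real.eulerMascheroniConstant)

lemma digammaSum_succ (L N : ℕ) : digammaSum (L + 1) (N + 1) =
    ((harmonic N : ℝ) - Real.eulerMascheroniConstant) + digammaSum L N := by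
  unfold digammaSum
  rw [← Finset.Ico_add_one_right_eq_Icc, ← Finset.Ico_add_one_right_eq_Icc,
    Finset.sum_eq_sum_Ico_succ_bot (by omega)]
  congr 1
  rw [← Finset.sum_Ico_add' _ 1 (L + 1) 1]
  simp only [Nat.add_sub_add_right]

/-- Induction on rows: the first row contributes its squared norm, and the others, in coordinates on
its orthogonal complement, form an `L × N` Gaussian matrix whatever that first row is. -/
theorem hasLogMean_wide {L N : ℕ} (h : L ≤ N) :
    HasLogMean (fun G : Matrix (Fin L) (Fin N) ℂ => (G * Gᴴ).det) (gaussianMatrix (Fin L) (Fin N))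
      (digammaSum L N) := by
  induction L generalizing N with
  | zero => exact ⟨by simp, by simp, by simp [digammaSum]⟩
  | succ L ih =>
    obtain ⟨N, rfl⟩ : ∃ n, N = n + 1 := ⟨N - 1, by omega⟩
    rw [digammaSum_succ]
    have hcons : Continuous fun p : (Fin (N + 1) → ℂ) × Matrix (Fin L) (Fin (N + 1)) ℂ =>
        (of (vecCons p.1 p.2) : Matrix (Fin (L + 1)) (Fin (N + 1)) ℂ) := by
      refine continuous_matrix fun i j => ?_
      refine Fin.cases ?_ (fun i => ?_) i
      · exact (continuous_apply j).comp continuous_fst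
      · exact continuous_snd.matrix_elem i j
    have hcont : Continuous fun p : (Fin (N + 1) → ℂ) × Matrix (Fin L) (Fin (N + 1)) ℂ =>
        (of (vecCons p.1 p.2) : Matrix (Fin (L + 1)) (Fin (N + 1)) ℂ) * (of (vecCons p.1 p.2))ᴴ :=
      hcons.matrix_mul hcons.matrix_conjTranspose
    have hp := hasLogMean_gaussianVector.prod_of_section
      (ν := gaussianMatrix (Fin L) (Fin (N + 1)))
      (D := fun p => (of (vecCons p.1 p.2) * (of (vecCons p.1 p.2))ᴴ).det)
      (Continuous.measurable hcont.matrix_det) (ih (by omega : L ≤ N)) ?_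
    · refine (hp.comp (measurePreserving_piFinSuccAbove
        (fun _ : Fin (L + 1) => gaussianVector (Fin (N + 1))) 0)).congr fun G => ?_
      have : of (vecCons (MeasurableEquiv.piFinSuccAbove (fun _ => Fin (N + 1) → ℂ) 0 G).1
        (MeasurableEquiv.piFinSuccAbove (fun _ => Fin (N + 1) → ℂ) 0 G).2) = G := by
        ext i j
        refine Fin.cases ?_ (fun i => ?_) i <;> rfl
      rw [this]
    · filter_upwards [ae_ne_zero_gaussianVector (ι := Fin (N + 1))] with v hv
      obtain ⟨U, hU, hU'⟩ := exists_isometry_orthogonal hv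
      refine ⟨fun G => G * U, measurePreserving_mul_right U hU, fun G => ?_⟩
      rw [← norm_mul, ← det_cons_mul_conjTranspose hv hU']

theorem hasLogMean_tall {L N : ℕ} (h : L ≤ N) :
    HasLogMean (fun G : Matrix (Fin N) (Fin L) ℂ => (Gᴴ * G).det) (gaussianMatrix (Fin N) (Fin L))
      (digammaSum L N) := by
  refine ((hasLogMean_wide h).comp measurePreserving_transpose).congr fun G => ?_
  rw [← det_transpose, transpose_mul, transpose_transpose, conjTranspose, conjTranspose,
    transpose_map, transpose_transpose]

end

/-! ### Deterministic bounds for `log det (I + q Y)` -/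

section
open scoped ComplexOrder
variable {ι κ : Type*} [Fintype ι] [Fintype κ]

lemma det_one_add_smul_eq_prod [DecidableEq ι] {Y : Matrix ι ι ℂ} (hY : Y.IsHermitian) (q : ℝ) :
    (1 + (q : ℂ) • Y).det = ((∏ i, (1 + q * hY.eigenvalues i) : ℝ) : ℂ) := by
  have e : (1 + (q : ℂ) • Y) = 1 + (hY.eigenvectorUnitary : Matrix ι ι ℂ) *
      ((q : ℂ) • (diagonal (RCLike.ofReal ∘ hY.eigenvalues) *
        (star hY.eigenvectorUnitary : Matrix ι ι ℂ))) := by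
    conv_lhs => rw [hY.spectral_theorem, Unitary.conjStarAlgAut_apply]
    rw [Matrix.mul_smul, Matrix.mul_assoc]
  rw [e, det_one_add_mul_comm, Matrix.smul_mul, Matrix.mul_assoc, Unitary.coe_star_mul_self,
    Matrix.mul_one, ← diagonal_one, ← diagonal_smul, diagonal_add, det_diagonal]
  simp

/-- With `s` the slope at `m`, one has `1 + q exp x = a (1 - s + s exp (x - m))`, and convexity of
`exp` bounds the bracket below by `exp (s (x - m))`. -/
lemma log_one_add_mul_exp_tangent {q : ℝ} (hq : 0 ≤ q) (m x : ℝ) :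
    Real.log (1 + q * Real.exp m) + q * Real.exp m / (1 + q * Real.exp m) * (x - m) ≤
      Real.log (1 + q * Real.exp x) := by
  set a := 1 + q * Real.exp m with ha
  have ha0 : 0 < a := by positivity
  set s := q * Real.exp m / a with hs
  have hs0 : 0 ≤ s := by positivity
  have hs1 : 1 - s = 1 / a := by rw [hs, ha]; field_simp; ring
  have h1 : 0 ≤ 1 - s := by rw [hs1]; positivity
  have hconv := convexOn_exp.2 (Set.mem_univ 0) (Set.mem_univ (x - m)) h1 hs0 (by ring)
  simp only [smul_eq_mul, mul_zero, zero_add, Real.exp_zero, mul_one] at hconv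
  have h2 : 1 + q * Real.exp x = a * (1 - s + s * Real.exp (x - m)) := by
    rw [hs1, hs, Real.exp_sub]
    field_simp
  have hpos : 0 < 1 - s + s * Real.exp (x - m) := (Real.exp_pos _).trans_le hconv
  rw [h2, Real.log_mul ha0.ne' hpos.ne']
  gcongr
  rwa [Real.le_log_iff_exp_le hpos]

/-- The same tangent point `m` serves all eigenvalues, so the linear terms add up to `log ‖Y.det‖`.
-/
lemma log_det_one_add_ge [DecidableEq ι] {Y : Matrix ι ι ℂ} (hY : Y.PosSemidef) (hdet : Y.det ≠ 0)
    {q : ℝ} (hq : 0 ≤ q) (m : ℝ) :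
    Fintype.card ι * Real.log (1 + q * Real.exp m) +
        q * Real.exp m / (1 + q * Real.exp m) * (Real.log ‖Y.det‖ - Fintype.card ι * m) ≤
      Real.log (1 + (q : ℂ) • Y).det.re := by
  have hne : ∀ i, hY.1.eigenvalues i ≠ 0 := by
    intro i hi
    apply hdet
    rw [hY.1.det_eq_prod_eigenvalues]
    exact Finset.prod_eq_zero (Finset.mem_univ i) (by simp [hi])
  have hpos : ∀ i, 0 < hY.1.eigenvalues i := fun i =>
    (hY.eigenvalues_nonneg i).lt_of_ne (hne i).symm
  rw [det_one_add_smul_eq_prod hY.1, Complex.ofReal_re, hY.1.det_eq_prod_eigenvalues,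
    norm_prod, Real.log_prod fun i _ => norm_ne_zero_iff.2 (RCLike.ofReal_ne_zero.2 (hne i)),
    Real.log_prod fun i _ => (by have := hpos i; positivity)]
  calc _ = ∑ i, (Real.log (1 + q * Real.exp m) + q * Real.exp m / (1 + q * Real.exp m) *
        (Real.log (hY.1.eigenvalues i) - m)) := by
        rw [Finset.sum_add_distrib, ← Finset.mul_sum, Finset.sum_sub_distrib]
        simp [abs_of_pos (hpos _)]
    _ ≤ _ := Finset.sum_le_sum fun i _ => by
        have := log_one_add_mul_exp_tangent hq m (Real.log (hY.1.eigenvalues i))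
        rwa [Real.exp_log (hpos i)] at this

lemma log_det_one_add_nonneg [DecidableEq ι] {Y : Matrix ι ι ℂ} (hY : Y.PosSemidef)
    {q : ℝ} (hq : 0 ≤ q) : 0 ≤ Real.log (1 + (q : ℂ) • Y).det.re := by
  rw [det_one_add_smul_eq_prod hY.1, Complex.ofReal_re]
  have hpos : ∀ i, 1 ≤ 1 + q * hY.1.eigenvalues i := fun i =>
    le_add_of_nonneg_right (mul_nonneg hq (hY.eigenvalues_nonneg i))
  rw [Real.log_prod fun i _ => (zero_lt_one.trans_le (hpos i)).ne']
  exact Finset.sum_nonneg fun i _ => Real.log_nonneg (hpos i)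

lemma log_det_one_add_le [DecidableEq ι] {Y : Matrix ι ι ℂ} (hY : Y.PosSemidef)
    {q : ℝ} (hq : 0 ≤ q) : Real.log (1 + (q : ℂ) • Y).det.re ≤ q * Y.trace.re := by
  have hpos : ∀ i, 0 < 1 + q * hY.1.eigenvalues i := fun i => by
    have := mul_nonneg hq (hY.eigenvalues_nonneg i)
    linarith
  rw [det_one_add_smul_eq_prod hY.1, Complex.ofReal_re, hY.1.trace_eq_sum_eigenvalues,
    Real.log_prod fun i _ => (hpos i).ne']
  calc _ ≤ ∑ i, q * hY.1.eigenvalues i := Finset.sum_le_sum fun i _ => by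
        linarith [Real.log_le_sub_one_of_pos (hpos i)]
    _ = _ := by
      rw [← Finset.mul_sum]
      simp

/-- A square `R` can replace a rectangular factor with the same Gram matrix, and its determinant is
multiplicative. -/
lemma exists_eq_conjTranspose_mul_self [DecidableEq ι] {Y : Matrix ι ι ℂ} (hY : Y.PosSemidef) :
    ∃ R : Matrix ι ι ℂ, Y = Rᴴ * R := by
  refine ⟨diagonal (fun i => (√(hY.1.eigenvalues i) : ℂ)) *
    (star hY.1.eigenvectorUnitary : Matrix ι ι ℂ), ?_⟩
  conv_lhs => rw [hY.1.spectral_theorem, Unitary.conjStarAlgAut_apply]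
  rw [conjTranspose_mul, diagonal_conjTranspose, ← Matrix.mul_assoc, Matrix.mul_assoc (star _)ᴴ,
    diagonal_mul_diagonal, star_eq_conjTranspose, conjTranspose_conjTranspose]
  congr 3
  ext i
  have h : ∀ x : ℝ, 0 ≤ x → (x : ℂ) = star (√x : ℂ) * √x := fun x hx => by
    rw [RCLike.star_def, Complex.conj_ofReal, ← Complex.ofReal_mul, Real.mul_self_sqrt hx]
  exact h _ (hY.eigenvalues_nonneg i)

/-- Submultiplicativity of the Frobenius norm, by Cauchy–Schwarz; it gives an integrable majorant
that splits over the two factors. -/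
lemma trace_mul_le {ρ : Type*} [Fintype ρ] (B : Matrix ρ κ ℂ) (A : Matrix κ ι ℂ) :
    ((B * A)ᴴ * (B * A)).trace.re ≤ (∑ i, ∑ j, ‖B i j‖ ^ 2) * ∑ i, ∑ j, ‖A i j‖ ^ 2 := by
  have h : ((B * A)ᴴ * (B * A)).trace.re = ∑ j, ∑ i, ‖(B * A) i j‖ ^ 2 := by
    simp only [trace, diag_apply, mul_apply, conjTranspose_apply, Complex.re_sum]
    refine Finset.sum_congr rfl fun j _ => Finset.sum_congr rfl fun i _ => ?_
    rw [← Complex.normSq_eq_norm_sq, ← Complex.ofReal_re (Complex.normSq _),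
      Complex.normSq_eq_conj_mul_self]
    rfl
  rw [h, Finset.sum_comm, Finset.sum_mul]
  refine Finset.sum_le_sum fun i _ => ?_
  rw [Finset.sum_comm (f := fun i j => ‖A i j‖ ^ 2), Finset.mul_sum]
  refine Finset.sum_le_sum fun j _ => ?_
  calc ‖(B * A) i j‖ ^ 2 ≤ (∑ k, ‖B i k‖ * ‖A k j‖) ^ 2 := by
        gcongr
        rw [mul_apply]
        exact (norm_sum_le _ _).trans_eq (by simp)
    _ ≤ _ := Finset.sum_mul_sq_le_sq_mul_sq _ _ _

lemma integrable_norm_sq_complexGaussian : Integrable (fun z => ‖z‖ ^ 2) complexGaussian := by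
  have h : Integrable (fun x : ℝ => x ^ 2) (gaussianReal 0 (1 / 2)) :=
    (memLp_id_gaussianReal 2).integrable_sq
  have hm : Measurable (fun p : ℝ × ℝ => (⟨p.1, p.2⟩ : ℂ)) :=
    Complex.measurableEquivRealProd.symm.measurable
  rw [complexGaussian, integrable_map_measure (by fun_prop) hm.aemeasurable]
  refine ((h.comp_fst _).add (h.comp_snd _)).congr (ae_of_all _ fun p => ?_)
  simp only [Pi.add_apply, Function.comp_apply]
  rw [← Complex.normSq_eq_norm_sq, Complex.normSq_mk, ← sq, ← sq]

lemma integrable_sum_norm_sq_gaussianMatrix :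
    Integrable (fun G : Matrix ι κ ℂ => ∑ i, ∑ j, ‖G i j‖ ^ 2) (gaussianMatrix ι κ) := by
  refine integrable_finsetSum _ fun i _ => integrable_finsetSum _ fun j _ => ?_
  exact ((measurePreserving_eval (fun _ : κ => complexGaussian) j).comp
    (measurePreserving_eval (fun _ : ι => gaussianVector κ) i)).integrable_comp_of_integrable
      integrable_norm_sq_complexGaussian

end

/-! ### The product channel: logarithmic means, Jensen's bound and the joint law -/

section
open scoped ComplexOrder
variable {M K N : ℕ}

/-- The joint law of the two factors of a Rayleigh product channel. -/
noncomputable abbrev gaussianPair (M K N : ℕ) :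
    Measure (Matrix (Fin K) (Fin M) ℂ × Matrix (Fin N) (Fin K) ℂ) :=
  (gaussianMatrix (Fin K) (Fin M)).prod (gaussianMatrix (Fin N) (Fin K))

lemma exists_isometry_mul_eq {ι κ : Type*} [Fintype ι] [Fintype κ] [DecidableEq κ]
    {A : Matrix ι κ ℂ} (hA : (Aᴴ * A).det ≠ 0) :
    ∃ (U : Matrix ι κ ℂ) (R : Matrix κ κ ℂ), Uᴴ * U = 1 ∧ A = U * R := by
  obtain ⟨R, hR⟩ := exists_eq_conjTranspose_mul_self (posSemidef_conjTranspose_mul_self A)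
  have hdet : IsUnit R.det := by
    rw [hR, det_mul] at hA
    exact (right_ne_zero_of_mul hA).isUnit
  refine ⟨A * R⁻¹, R, ?_, ?_⟩
  · rw [conjTranspose_mul, Matrix.mul_assoc, ← Matrix.mul_assoc Aᴴ, hR, Matrix.mul_assoc,
      mul_nonsing_inv _ hdet, Matrix.mul_one, ← conjTranspose_mul, mul_nonsing_inv _ hdet,
      conjTranspose_one]
  · rw [Matrix.mul_assoc, nonsing_inv_mul _ hdet, Matrix.mul_one]

/-- For fixed `A = U R` with `U† U = 1`, the matrix `B U` is Gaussian of size `N × M`, and the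
determinant splits into those of `A† A` and `(B U)† (B U)`. -/
theorem hasLogMean_mul_tall (hK : M ≤ K) (hN : M ≤ N) :
    HasLogMean (fun p => ((p.2 * p.1)ᴴ * (p.2 * p.1)).det) (gaussianPair M K N)
      (digammaSum M K + digammaSum M N) := by
  have hc : Continuous fun p : Matrix (Fin K) (Fin M) ℂ × Matrix (Fin N) (Fin K) ℂ =>
      ((p.2 * p.1)ᴴ * (p.2 * p.1)).det := by fun_prop
  refine (hasLogMean_tall hK).prod_of_section hc.measurable (hasLogMean_tall hN) ?_
  filter_upwards [(hasLogMean_tall hK).ae_ne_zero] with A hA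
  obtain ⟨U, R, hU, hAR⟩ := exists_isometry_mul_eq hA
  refine ⟨fun B => B * U, measurePreserving_mul_right U hU, fun B => ?_⟩
  have h1 : (Aᴴ * A).det = (Rᴴ).det * R.det := by
    rw [hAR, conjTranspose_mul, Matrix.mul_assoc, ← Matrix.mul_assoc Uᴴ, hU, Matrix.one_mul, det_mul]
  have h2 : (B * A)ᴴ * (B * A) = Rᴴ * ((B * U)ᴴ * (B * U)) * R := by
    rw [hAR]
    simp only [conjTranspose_mul, Matrix.mul_assoc]
  rw [← norm_mul, h1, h2, det_mul, det_mul]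
  ring_nf

/-- Transposition exchanges the roles of the two factors. -/
theorem hasLogMean_mul_wide (hM : N ≤ M) (hK : N ≤ K) :
    HasLogMean (fun p => ((p.2 * p.1) * (p.2 * p.1)ᴴ).det) (gaussianPair M K N)
      (digammaSum N K + digammaSum N M) := by
  have ht := ((measurePreserving_transpose (ι := Fin K) (κ := Fin M)).prod
    (measurePreserving_transpose (ι := Fin N) (κ := Fin K)))
  have hs := Measure.measurePreserving_swap.comp ht
  refine ((hasLogMean_mul_tall (M := N) (K := K) (N := M) hK hM).comp hs).congr fun p => ?_
  congr 1
  simp only [Function.comp_apply, Prod.map, Prod.swap]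
  rw [← transpose_mul, ← det_transpose, transpose_mul, transpose_transpose, conjTranspose,
    conjTranspose, transpose_map, transpose_transpose]

/-- When `K` is least, both Gram matrices of `Q` may be singular; this product takes the place of
their determinants. -/
theorem hasLogMean_mul_inner (hM : K ≤ M) (hN : K ≤ N) :
    HasLogMean (fun p => (p.1 * p.1ᴴ).det * (p.2ᴴ * p.2).det) (gaussianPair M K N)
      (digammaSum K M + digammaSum K N) := by
  have hc : Continuous fun p : Matrix (Fin K) (Fin M) ℂ × Matrix (Fin N) (Fin K) ℂ =>
      (p.1 * p.1ᴴ).det * (p.2ᴴ * p.2).det := by fun_prop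
  exact (hasLogMean_wide hM).prod_of_section hc.measurable (hasLogMean_tall hN)
    (ae_of_all _ fun A => ⟨id, MeasurePreserving.id _, fun B => norm_mul _ _⟩)

lemma integrable_log_det {q : ℝ} (hq : 0 ≤ q) :
    Integrable (fun p => Real.log (1 + (q : ℂ) • ((p.2 * p.1)ᴴ * (p.2 * p.1))).det.re)
      (gaussianPair M K N) := by
  have hc : Continuous fun p : Matrix (Fin K) (Fin M) ℂ × Matrix (Fin N) (Fin K) ℂ =>
      (1 + (q : ℂ) • ((p.2 * p.1)ᴴ * (p.2 * p.1))).det.re :=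
    Complex.continuous_re.comp (by fun_prop)
  refine (((integrable_sum_norm_sq_gaussianMatrix (ι := Fin K) (κ := Fin M)).mul_prod
    (integrable_sum_norm_sq_gaussianMatrix (ι := Fin N) (κ := Fin K))).const_mul q).mono'
    (Real.measurable_log.comp hc.measurable).aestronglyMeasurable (ae_of_all _ fun p => ?_)
  have hpos := posSemidef_conjTranspose_mul_self (p.2 * p.1)
  rw [Real.norm_of_nonneg (log_det_one_add_nonneg hpos hq)]
  refine (log_det_one_add_le hpos hq).trans (mul_le_mul_of_nonneg_left ?_ hq)
  rw [mul_comm]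
  exact trace_mul_le _ _

/-- If `I + q Q† Q` has the determinant of `I + q Y` for a positive semidefinite `Y` of size `L`
whose determinant has the logarithmic mean `L m`, then the mean of `log det (I + q Q† Q)` is at least
`L log (1 + q exp m)`. -/
lemma le_integral_log_det {q : ℝ} (hq : 0 ≤ q) {L : ℕ} {m : ℝ}
    {D : Matrix (Fin K) (Fin M) ℂ × Matrix (Fin N) (Fin K) ℂ → ℂ}
    (hD : HasLogMean D (gaussianPair M K N) (L * m))
    (h : ∀ p, ∃ Y : Matrix (Fin L) (Fin L) ℂ, Y.PosSemidef ∧ Y.det = D p ∧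
      (1 + (q : ℂ) • ((p.2 * p.1)ᴴ * (p.2 * p.1))).det = (1 + (q : ℂ) • Y).det) :
    L * Real.log (1 + q * Real.exp m) ≤
      ∫ p, Real.log (1 + (q : ℂ) • ((p.2 * p.1)ᴴ * (p.2 * p.1))).det.re ∂(gaussianPair M K N) := by
  set s := q * Real.exp m / (1 + q * Real.exp m)
  have hi : Integrable (fun p => s * (Real.log ‖D p‖ - L * m)) (gaussianPair M K N) :=
    (hD.integrable.sub (integrable_const _)).const_mul s
  -- `L * m` is the mean of `log ‖D‖`, so the linear term integrates to zero.
  calc L * Real.log (1 + q * Real.exp m)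
      = ∫ p, (L * Real.log (1 + q * Real.exp m) + s * (Real.log ‖D p‖ - L * m))
          ∂(gaussianPair M K N) := by
        rw [integral_add (integrable_const _) hi, integral_const_mul s,
          integral_sub hD.integrable (integrable_const _), hD.integral_eq]
        simp
    _ ≤ _ := by
        refine integral_mono_ae ((integrable_const _).add hi) (integrable_log_det hq) ?_
        filter_upwards [hD.ae_ne_zero] with p hp
        obtain ⟨Y, hY, hYD, hYq⟩ := h p
        have := log_det_one_add_ge hY (hYD ▸ hp) hq m
        rw [Fintype.card_fin, hYD] at this
        rw [hYq]
        exact this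

lemma digammaSum_add (hL : 0 < L₁ M K N) :
    digammaSum (L₁ M K N) (L₂ M K N) + digammaSum (L₁ M K N) (L₃ M K N) =
      L₁ M K N * (g M K N - 2 * Real.eulerMascheroniConstant) := by
  have : (L₁ M K N : ℝ) ≠ 0 := by positivity
  unfold digammaSum g
  rw [← Finset.sum_add_distrib, mul_sub, ← mul_assoc, mul_one_div_cancel this, one_mul,
    Finset.sum_congr rfl fun l _ => show _ = ((harmonic (L₂ M K N - l) : ℝ) +
      (harmonic (L₃ M K N - l) : ℝ)) - 2 * Real.eulerMascheroniConstant by ring,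
    Finset.sum_sub_distrib]
  simp

lemma digammaSum_add_eq {a b : ℕ} (hL : 0 < L₁ M K N)
    (h : (a = L₂ M K N ∧ b = L₃ M K N) ∨ (b = L₂ M K N ∧ a = L₃ M K N)) :
    digammaSum (L₁ M K N) a + digammaSum (L₁ M K N) b =
      L₁ M K N * (g M K N - 2 * Real.eulerMascheroniConstant) := by
  rcases h with ⟨rfl, rfl⟩ | ⟨rfl, rfl⟩
  · exact digammaSum_add hL
  · rw [add_comm]
    exact digammaSum_add hL

theorem le_integral_log_det_gaussianPair (hM : 0 < M) (hK : 0 < K) (hN : 0 < N)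
    {q : ℝ} (hq : 0 ≤ q) :
    L₁ M K N * Real.log (1 + q * Real.exp (g M K N - 2 * Real.eulerMascheroniConstant)) ≤
      ∫ p, Real.log (1 + (q : ℂ) • ((p.2 * p.1)ᴴ * (p.2 * p.1))).det.re ∂(gaussianPair M K N) := by
  have hL : 0 < L₁ M K N := by unfold L₁; omega
  by_cases h1 : M ≤ K ∧ M ≤ N
  · have e : L₁ M K N = M := by unfold L₁; omega
    have hs := digammaSum_add_eq (a := K) (b := N) hL (by unfold L₂ L₃ L₁; omega)
    rw [e] at hs ⊢
    exact le_integral_log_det hq (hs ▸ hasLogMean_mul_tall h1.1 h1.2) fun p =>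
      ⟨_, posSemidef_conjTranspose_mul_self _, rfl, rfl⟩
  by_cases h2 : N ≤ M ∧ N ≤ K
  · have e : L₁ M K N = N := by unfold L₁; omega
    have hs := digammaSum_add_eq (a := K) (b := M) hL (by unfold L₂ L₃ L₁; omega)
    rw [e] at hs ⊢
    refine le_integral_log_det hq (hs ▸ hasLogMean_mul_wide h2.1 h2.2) fun p =>
      ⟨_, posSemidef_self_mul_conjTranspose _, rfl, ?_⟩
    -- Sylvester's identity passes from `Q† Q` to the smaller `Q Q†`.
    rw [← Matrix.smul_mul, det_one_add_mul_comm, Matrix.mul_smul]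
  · have h3 : K ≤ M ∧ K ≤ N := by omega
    have e : L₁ M K N = K := by unfold L₁; omega
    have hs := digammaSum_add_eq (a := M) (b := N) hL (by unfold L₂ L₃ L₁; omega)
    rw [e] at hs ⊢
    refine le_integral_log_det hq (hs ▸ hasLogMean_mul_inner h3.1 h3.2) fun ⟨A, B⟩ => ?_
    -- `Q† Q` depends on `B` only through `B† B = R† R`, so `Q` may be replaced by the `K × M`
    -- matrix `R A`.
    obtain ⟨R, hR⟩ := exists_eq_conjTranspose_mul_self (posSemidef_conjTranspose_mul_self B)
    refine ⟨(R * A) * (R * A)ᴴ, posSemidef_self_mul_conjTranspose _, ?_, ?_⟩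
    · rw [hR, conjTranspose_mul, Matrix.mul_assoc, ← Matrix.mul_assoc A, det_mul, det_mul, det_mul]
      ring
    · have : (B * A)ᴴ * (B * A) = (R * A)ᴴ * (R * A) := by
        rw [conjTranspose_mul, Matrix.mul_assoc, ← Matrix.mul_assoc Bᴴ, hR]
        simp only [conjTranspose_mul, Matrix.mul_assoc]
      rw [this, ← Matrix.smul_mul, det_one_add_mul_comm, Matrix.mul_smul]

/-- Joint independence makes the family of all entries a product law over the sum of the index
types; splitting the sum and regrouping by rows gives the pair of matrices. -/
lemma IsRayleighProduct.hasLaw {Ω : Type*} [MeasurableSpace Ω] {P : Measure Ω}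
    [IsProbabilityMeasure P] {Q₁ : Ω → Matrix (Fin K) (Fin M) ℂ}
    {Q₂ : Ω → Matrix (Fin N) (Fin K) ℂ} (hQ : IsRayleighProduct Q₁ Q₂ P) :
    HasLaw (fun ω => (Q₁ ω, Q₂ ω)) (gaussianPair M K N) P := by
  set f : (Fin K × Fin M) ⊕ (Fin N × Fin K) → Ω → ℂ :=
    Sum.elim (fun i ω => Q₁ ω i.1 i.2) (fun j ω => Q₂ ω j.1 j.2)
  have hlaw : ∀ i, HasLaw (f i) complexGaussian P := by
    rintro (i | j)
    · exact hQ.hasLaw_fst i.1 i.2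
    · exact hQ.hasLaw_snd j.1 j.2
  have hm : AEMeasurable (fun ω i => f i ω) P :=
    aemeasurable_pi_lambda _ fun i => (hlaw i).aemeasurable
  have hpi : P.map (fun ω i => f i ω) = gaussianVector ((Fin K × Fin M) ⊕ (Fin N × Fin K)) := by
    rw [(iIndepFun_iff_map_fun_eq_pi_map fun i => (hlaw i).aemeasurable).1 hQ.indep]
    congr 1
    ext1 i
    exact (hlaw i).map_eq
  have hT := (measurePreserving_uncurryEquiv_symm (ι := Fin K) (κ := Fin M)).prod
    (measurePreserving_uncurryEquiv_symm (ι := Fin N) (κ := Fin K)) |>.comp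
    (measurePreserving_sumPiEquivProdPi
      (fun _ : (Fin K × Fin M) ⊕ (Fin N × Fin K) => complexGaussian))
  refine ⟨hT.measurable.comp_aemeasurable hm, ?_⟩
  refine Eq.trans ?_ ((congrArg (Measure.map _) hpi).trans hT.map_eq)
  rw [AEMeasurable.map_map_of_aemeasurable hT.measurable.aemeasurable hm]
  rfl

end

end RayleighProduct

theorem proposition1 {Ω : Type*} [MeasurableSpace Ω] (P : Measure Ω) [IsProbabilityMeasure P]
    (M K N : ℕ) (hM : 0 < M) (hK : 0 < K) (hN : 0 < N)
    (Q₁ : Ω → Matrix (Fin K) (Fin M) ℂ) (Q₂ : Ω → Matrix (Fin N) (Fin K) ℂ)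
    (hQ : RayleighProduct.IsRayleighProduct Q₁ Q₂ P)
    (b : ℝ) (hb : 1 < b) (q : ℝ) (hq : 0 ≤ q) :
    Integrable (fun ω => RayleighProduct.capacity b q (Q₂ ω * Q₁ ω)) P ∧
      (RayleighProduct.L₁ M K N : ℝ) * Real.logb b
          (1 + q * Real.exp (RayleighProduct.g M K N - 2 * Real.eulerMascheroniConstant)) ≤
        RayleighProduct.ergodicCapacity b q (fun ω => Q₂ ω * Q₁ ω) P := by
  have hlaw := hQ.hasLaw
  have hi := RayleighProduct.integrable_log_det (M := M) (K := K) (N := N) hq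
  have hle := RayleighProduct.le_integral_log_det_gaussianPair hM hK hN hq
  rw [← hlaw.map_eq] at hi hle
  rw [integral_map hlaw.aemeasurable hi.1] at hle
  have hi' := hi.comp_aemeasurable hlaw.aemeasurable
  refine ⟨hi'.div_const (Real.log b), ?_⟩
  unfold RayleighProduct.ergodicCapacity RayleighProduct.capacity Real.logb
  rw [integral_div, ← mul_div_assoc]
  exact div_le_div_of_nonneg_right hle (Real.log_pos hb).le
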